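/- Let $0\le l\le n$ be integers and let $\mathcal H_l^{(n)}$ be the complex Hilbert space with orthonormal basis $\{|x\rangle\}$ indexed by the binary strings $x\in\{0,1\}^n$ containing exactly $l$ ones. For $0\le k\le l$ let $$A_k^{(l)}=\sum_{x,y:\ d(x,y)=2k}|x\rangle\langle y|,$$ where $d$ is the Hamming distance and $x,y$ range over these strings. For $0\le k\le l$ and $0\le j\le\min\{l,n-l\}$ put $$\alpha_k(j)=\sum_{r=0}^{k}(-1)^{k-r}\binom{l-r}{k-r}\binom{l-j}{r}\binom{n-l-j+r}{r},$$ and for real $u$ put $$E_k(u)=(-1)^k\binom{l}{k}\;{}_3F_2\!\left(\begin{matrix}-k,\ -l+u,\ n-l-u+1\\ -l,\ 1\end{matrix};1\right),$$ the series terminating after the term of index $k$. Then: 1. For every $0\le k\le l$, the eigenvalues of $A_k^{(l)}$ are exactly the numbers $\alpha_k(j)$, $j=0,1,\dots,\min\{l,n-l\}$. 2. The index $j$ labels the common eigenspaces of the operators $A_0^{(l)},\dots,A_l^{(l)}$: if $B_j$ denotes the space of all $v\in\mathcal H_l^{(n)}$ with $A_k^{(l)}v=\alpha_k(j)v$ for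 all $0\le k\le l$, then $\mathcal H_l^{(n)}=\bigoplus_{j=0}^{\min\{l,n-l\}}B_j$ is an orthogonal direct sum, and $\dim B_j=\binom nj\frac{n-2j+1}{n-j+1}$. 3. $\alpha_k(j)=E_k(j)$ for all $0\le k\le l$ and $0\le j\le\min\{l,n-l\}$. 4. $E_k$ is, up to normalization, a dual Hahn polynomial: for every $0\le k\le l$ there is a real polynomial $R_k$ of degree $k$ such that, with $\gamma=0$, $\delta=n-2l$, $N=l$, $$R_k\big(x(x+\gamma+\delta+1)\big)={}_3F_2\!\left(\begin{matrix}-k,\ -x,\ x+\gamma+\delta+1\\ -N,\ \gamma+1\end{matrix};1\right)\quad\text{for all real }x,$$ and $E_k(u)=(-1)^k\binom lk R_k\big((l-u)(n-l-u+1)\big)$ for all real $u$. 5. Identifying a string $x$ with the $l$-element set of positions of its ones, the matrix of $A_k^{(l)}$ $(0\le k\le l)$ in the basis $\{|x\rangle\}$ is the adjacency matrix of the relation $|s\cap t|=l-k$ of the Johnson scheme on the $l$-element subsets of an $n$-element set. -/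

import Mathlib

open Finset

noncomputable section

/-- Binary strings of length `n` containing exactly `l` ones (`hammingNorm` counts the nonzero
entries). -/
abbrev WeightString (n l : ℕ) : Type := {x : Fin n → Fin 2 // hammingNorm x = l}

/-- The Hilbert space `H_l^{(n)}`: the complex Hilbert space whose orthonormal basis is given by
the binary strings of length `n` and weight `l`. -/
abbrev WeightSpace (n l : ℕ) : Type := EuclideanSpace ℂ (WeightString n l)

/-- The standard basis vector `|x⟩`. -/
def ket {n l : ℕ} (x : WeightString n l) : WeightSpace n l := EuclideanSpace.single x 1

/-- The operator `A_k^{(l)} = ∑_{x, y : d(x, y) = 2k} |x⟩⟨y|` on `H_l^{(n)}`, with `d` the Hamming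
distance. -/
def opA (n l k : ℕ) : Module.End ℂ (WeightSpace n l) :=
  ∑ p : WeightString n l × WeightString n l with hammingDist p.1.1 p.2.1 = 2 * k,
    (InnerProductSpace.rankOne ℂ (ket p.1) (ket p.2)).toLinearMap

/-- `α_k(j) = ∑_{r=0}^k (-1)^{k-r} C(l-r, k-r) C(l-j, r) C(n-l-j+r, r)`. It is only used for
`l ≤ n`, `k ≤ l`, `j ≤ min l (n-l)`, where no subtraction is truncated. -/
def alpha (n l k j : ℕ) : ℤ :=
  ∑ r ∈ range (k + 1), (-1) ^ (k - r) *
    ((l - r).choose (k - r) * (l - j).choose r * (n - l - j + r).choose r : ℕ)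

/-- The common eigenspace of `A_0^{(l)}, …, A_l^{(l)}` on which each `A_k^{(l)}` acts as
the scalar `α_k(j)`. -/
def commonEigenspace (n l j : ℕ) : Submodule ℂ (WeightSpace n l) :=
  ⨅ k ∈ range (l + 1), (opA n l k).eigenspace (alpha n l k j : ℂ)

/-- The rising factorial `(a)_i = a (a + 1) ⋯ (a + i - 1)`. -/
def risingFact (a : ℝ) (i : ℕ) : ℝ := ∏ m ∈ range i, (a + m)

/-- The hypergeometric series `₃F₂(a₁, a₂, a₃; b₁, b₂; z)`. If `a₁ = -k` and `b₁ = -l` with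
naturals `k ≤ l`, then every term past `i = k` has numerator `0`, hence is `0`
(also where the denominator vanishes): this is the usual reading of a terminating series. -/
def hyp3F2 (a₁ a₂ a₃ b₁ b₂ z : ℝ) : ℝ :=
  ∑' i : ℕ, risingFact a₁ i * risingFact a₂ i * risingFact a₃ i /
    (risingFact b₁ i * risingFact b₂ i) * z ^ i / (i.factorial : ℝ)

/-- `E_k(u) = (-1)^k C(l, k) ₃F₂(-k, -l+u, n-l-u+1; -l, 1; 1)`. -/
def hahnE (n l k : ℕ) (u : ℝ) : ℝ :=
  (-1) ^ k * (l.choose k : ℝ) *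
    hyp3F2 (-(k : ℝ)) (-(l : ℝ) + u) ((n : ℝ) - l - u + 1) (-(l : ℝ)) 1 1

/-- `R` is the dual Hahn polynomial `R_k(·; γ, δ, N)` (`k ≤ N`): the polynomial of degree `k` in
the variable `λ(x) = x (x + γ + δ + 1)` with
`R_k(λ(x); γ, δ, N) = ₃F₂(-k, -x, x + γ + δ + 1; -N, γ + 1; 1)`. -/
def IsDualHahn (γ δ : ℝ) (N k : ℕ) (R : Polynomial ℝ) : Prop :=
  R.degree = k ∧ ∀ x : ℝ, R.eval (x * (x + γ + δ + 1)) =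
    hyp3F2 (-(k : ℝ)) (-x) (x + γ + δ + 1) (-(N : ℝ)) (γ + 1) 1

/-- The adjacency matrix of the `k`-th relation `|s ∩ t| = l - k` of the Johnson scheme on the
`l`-element subsets of an `n`-element set. -/
def johnsonAdj (n l k : ℕ) :
    Matrix {s : Finset (Fin n) // #s = l} {s : Finset (Fin n) // #s = l} ℂ :=
  Matrix.of fun s t => if #(s.1 ∩ t.1) + k = l then 1 else 0

/-- The bijection sending a string with `l` ones to the set of the positions of its ones. -/
def onesEquiv (n l : ℕ) : WeightString n l ≃ {s : Finset (Fin n) // #s = l} where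
  toFun x := ⟨univ.filter fun i => x.1 i ≠ 0, x.2⟩
  invFun s := ⟨fun i => if i ∈ s.1 then 1 else 0, by
    simpa [hammingNorm] using s.2⟩
  left_inv x := by
    ext i
    by_cases h : x.1 i = 0
    · simp [h]
    · have : x.1 i = 1 := by omega
      simp [this]
  right_inv s := by
    ext i
    simp

end

/-! ### Raising and lowering operators on the Boolean lattice -/

section BooleanLattice

variable {α : Type*} [Fintype α] [DecidableEq α]

/-! The argument is `sl₂` representation theory on functions on the Boolean lattice. Write U_r, D_r
for `upOp r`, `downOp r`; these are divided powers of U_1, D_1, and the commutator [D_1, U_1] is the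
scalar n - 2i on level i (`downOp_upOp_one`). If v lives on level j and D_1 v = 0, then U_r D_r acts
on U_{l-j} v as C(l-j, r) C(n-l-j+r, r) for r ≤ l (`downOp_upOp_of_downOp_eq_zero`, `upOp_upOp`). On
level l the kernel of U_r D_r is C(|s ∩ u|, l-r), so binomial inversion writes A_k as an alternating
combination of the U_r D_r (`opA_restrictWeight`). Hence A_k U_{l-j} v = α_k(j) U_{l-j} v.

Completeness is a dimension count. Rank-nullity gives at least C(n, j) - C(n, j-1) independent such
v, and U_{l-j} is injective on them. The spaces B_j are mutually orthogonal, since the symmetric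
operator A_1 separates them (`alpha_one_injOn`), so their dimensions add up to at most C(n, l). The
lower bounds telescope to C(n, min(l, n-l)) = C(n, l), so every bound is an equality; surjectivity
of the lowering map is never needed.

The hypergeometric form holds term by term. -/

/-- The sum of `f` over the subsets of `s` with `r` elements fewer. -/
def upOp (r : ℕ) : (Finset α → ℂ) →ₗ[ℂ] (Finset α → ℂ) where
  toFun f s := ∑ t with t ⊆ s ∧ #t + r = #s, f t
  map_add' f g := by ext s; simp [sum_add_distrib]
  map_smul' c f := by ext s; simp [mul_sum]

/-- The sum of `f` over the supersets of `s` with `r` elements more. -/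
def downOp (r : ℕ) : (Finset α → ℂ) →ₗ[ℂ] (Finset α → ℂ) where
  toFun f s := ∑ t with s ⊆ t ∧ #s + r = #t, f t
  map_add' f g := by ext s; simp [sum_add_distrib]
  map_smul' c f := by ext s; simp [mul_sum]

lemma upOp_apply (r : ℕ) (f : Finset α → ℂ) (s : Finset α) :
    upOp r f s = ∑ t with t ⊆ s ∧ #t + r = #s, f t := rfl

lemma downOp_apply (r : ℕ) (f : Finset α → ℂ) (s : Finset α) :
    downOp r f s = ∑ t with s ⊆ t ∧ #s + r = #t, f t := rfl

lemma upOp_zero (f : Finset α → ℂ) : upOp 0 f = f := by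
  ext s
  have : ({t | t ⊆ s ∧ #t + 0 = #s} : Finset (Finset α)) = {s} := by
    ext t
    simp only [mem_filter, mem_univ, true_and, mem_singleton, add_zero]
    exact ⟨fun h => eq_of_subset_of_card_le h.1 h.2.ge, fun h => by simp [h]⟩
  rw [upOp_apply, this, sum_singleton]

lemma downOp_zero (f : Finset α → ℂ) : downOp 0 f = f := by
  ext s
  have : ({t | s ⊆ t ∧ #s + 0 = #t} : Finset (Finset α)) = {s} := by
    ext t
    simp only [mem_filter, mem_univ, true_and, mem_singleton, add_zero]
    exact ⟨fun h => (eq_of_subset_of_card_le h.1 h.2.ge).symm, fun h => by simp [h]⟩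
  rw [downOp_apply, this, sum_singleton]

lemma card_filter_between {u s : Finset α} (h : u ⊆ s) (a : ℕ) :
    #{t | u ⊆ t ∧ t ⊆ s ∧ #u + a = #t} = (#s - #u).choose a := by
  rw [← card_sdiff_of_subset h, ← card_powersetCard]
  refine card_nbij' (fun t => t \ u) (fun t => t ∪ u) ?_ ?_ ?_ ?_
  · intro t ht
    simp only [coe_filter, mem_univ, true_and, Set.mem_ofPred_eq] at ht
    simp only [mem_coe, mem_powersetCard]
    exact ⟨sdiff_subset_sdiff ht.2.1 le_rfl, by rw [card_sdiff_of_subset ht.1]; omega⟩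
  · intro t ht
    simp only [mem_coe, mem_powersetCard] at ht
    simp only [coe_filter, mem_univ, true_and, Set.mem_ofPred_eq]
    have hd : Disjoint t u := disjoint_of_subset_left ht.1 sdiff_disjoint
    exact ⟨subset_union_right, union_subset (ht.1.trans sdiff_subset) h,
      by rw [card_union_of_disjoint hd]; omega⟩
  · intro t ht
    simp only [coe_filter, mem_univ, true_and, Set.mem_ofPred_eq] at ht
    exact sdiff_union_of_subset ht.1
  · intro t ht
    simp only [mem_coe, mem_powersetCard] at ht
    have hd : Disjoint t u := disjoint_of_subset_left ht.1 sdiff_disjoint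
    exact union_sdiff_cancel_right hd

/-- Each u below s is reached through C(q+r, r) intermediate sets; thus `upOp r` plays the role of
U^r / r!. -/
lemma upOp_upOp (q r : ℕ) (f : Finset α → ℂ) :
    upOp q (upOp r f) = ((q + r).choose r : ℂ) • upOp (q + r) f := by
  ext s
  simp only [upOp_apply, Pi.smul_apply, smul_eq_mul, mul_sum]
  rw [sum_comm' (t' := {u | u ⊆ s ∧ #u + (q + r) = #s})
    (s' := fun u => {t | u ⊆ t ∧ t ⊆ s ∧ #u + r = #t})]
  · refine sum_congr rfl fun u hu => ?_
    simp only [mem_filter, mem_univ, true_and] at hu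
    rw [sum_const, card_filter_between hu.1, nsmul_eq_mul,
      show #s - #u = q + r by omega]
  · intro t u
    simp only [mem_filter, mem_univ, true_and]
    constructor
    · rintro ⟨⟨h1, h2⟩, h3, h4⟩
      exact ⟨⟨h3, h1, h4⟩, h3.trans h1, by omega⟩
    · rintro ⟨⟨h3, h1, h4⟩, h5, h6⟩
      exact ⟨⟨h1, by omega⟩, h3, h4⟩

lemma downOp_downOp (q r : ℕ) (f : Finset α → ℂ) :
    downOp q (downOp r f) = ((q + r).choose q : ℂ) • downOp (q + r) f := by
  ext s
  simp only [downOp_apply, Pi.smul_apply, smul_eq_mul, mul_sum]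
  rw [sum_comm' (t' := {u | s ⊆ u ∧ #s + (q + r) = #u})
    (s' := fun u => {t | s ⊆ t ∧ t ⊆ u ∧ #s + q = #t})]
  · refine sum_congr rfl fun u hu => ?_
    simp only [mem_filter, mem_univ, true_and] at hu
    rw [sum_const, card_filter_between hu.1, nsmul_eq_mul,
      show #u - #s = q + r by omega]
  · intro t u
    simp only [mem_filter, mem_univ, true_and]
    constructor
    · rintro ⟨⟨h1, h2⟩, h3, h4⟩
      exact ⟨⟨h1, h3, h2⟩, h1.trans h3, by omega⟩
    · rintro ⟨⟨h3, h1, h4⟩, h5, h6⟩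
      exact ⟨⟨h3, h4⟩, h1, by omega⟩

/-- The intermediate sets between s and u are the subsets of s ∩ u of size #s - r; `hr` keeps this
subtraction from truncating. -/
lemma upOp_downOp_apply (r : ℕ) (f : Finset α → ℂ) (s : Finset α) (hr : r ≤ #s) :
    upOp r (downOp r f) s = ∑ u with #u = #s, ((#(s ∩ u)).choose (#s - r) : ℂ) * f u := by
  simp only [upOp_apply, downOp_apply]
  rw [sum_comm' (t' := {u | #u = #s}) (s' := fun u => powersetCard (#s - r) (s ∩ u))]
  · simp
  · intro t u
    simp only [mem_filter, mem_univ, true_and, mem_powersetCard, subset_inter_iff]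
    constructor
    · rintro ⟨⟨h1, h2⟩, h3, h4⟩
      exact ⟨⟨⟨h1, h3⟩, by omega⟩, by omega⟩
    · rintro ⟨⟨⟨h1, h3⟩, h2⟩, h4⟩
      exact ⟨⟨h1, by omega⟩, h3, by omega⟩

lemma upOp_one_apply (f : Finset α → ℂ) (s : Finset α) :
    upOp 1 f s = ∑ a ∈ s, f (s.erase a) := by
  rw [upOp_apply]
  symm
  refine sum_bij (fun a _ => s.erase a) ?_ ?_ ?_ ?_
  · intro a ha
    simpa [erase_subset] using card_erase_add_one ha
  · intro a ha b hb h
    exact (erase_inj s ha).1 h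
  · intro t ht
    simp only [mem_filter, mem_univ, true_and] at ht
    obtain ⟨a, ha, h⟩ := covBy_iff_exists_insert.1
      (covBy_iff_card_sdiff_eq_one.2 ⟨ht.1, by rw [card_sdiff_of_subset ht.1]; omega⟩)
    exact ⟨a, by simp [← h], by rw [← h, erase_insert ha]⟩
  · intros; rfl

lemma downOp_one_apply (f : Finset α → ℂ) (s : Finset α) :
    downOp 1 f s = ∑ a ∈ sᶜ, f (insert a s) := by
  rw [downOp_apply]
  symm
  refine sum_bij (fun a _ => insert a s) ?_ ?_ ?_ ?_
  · intro a ha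
    rw [mem_compl] at ha
    simp [card_insert_of_notMem ha]
  · intro a ha b hb h
    rw [mem_compl] at ha
    exact (insert_inj ha).1 h
  · intro t ht
    simp only [mem_filter, mem_univ, true_and] at ht
    obtain ⟨a, ha, h⟩ := covBy_iff_exists_insert.1
      (covBy_iff_card_sdiff_eq_one.2 ⟨ht.1, by rw [card_sdiff_of_subset ht.1]; omega⟩)
    exact ⟨a, by simpa using ha, h⟩
  · intros; rfl

/-- Swapping one element for another gives the same terms in either order; only the diagonal terms
differ, #sᶜ against #s. -/
lemma downOp_upOp_one (f : Finset α → ℂ) (s : Finset α) :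
    downOp 1 (upOp 1 f) s =
      upOp 1 (downOp 1 f) s + ((Fintype.card α : ℂ) - 2 * #s) * f s := by
  have h1 : downOp 1 (upOp 1 f) s =
      (#(sᶜ) : ℂ) * f s + ∑ a ∈ sᶜ, ∑ b ∈ s, f ((insert a s).erase b) := by
    rw [downOp_one_apply, ← nsmul_eq_mul, ← sum_const, ← sum_add_distrib]
    refine sum_congr rfl fun a ha => ?_
    rw [mem_compl] at ha
    rw [upOp_one_apply, sum_insert ha, erase_insert ha]
  have h2 : upOp 1 (downOp 1 f) s =
      (#s : ℂ) * f s + ∑ b ∈ s, ∑ a ∈ sᶜ, f ((insert a s).erase b) := by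
    rw [upOp_one_apply, ← nsmul_eq_mul, ← sum_const, ← sum_add_distrib]
    refine sum_congr rfl fun b hb => ?_
    rw [downOp_one_apply, compl_erase, sum_insert (by simpa using hb), insert_erase hb]
    congr 1
    refine sum_congr rfl fun a ha => ?_
    rw [mem_compl] at ha
    rw [erase_insert_of_ne (by rintro rfl; exact ha hb)]
  rw [h1, h2, sum_comm, card_compl, Nat.cast_sub (card_le_univ s)]
  ring

lemma upOp_eq_zero {j : ℕ} {v : Finset α → ℂ} (hv : ∀ s, #s ≠ j → v s = 0) (m : ℕ)
    (s : Finset α) (hs : #s ≠ j + m) : upOp m v s = 0 := by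
  rw [upOp_apply]
  refine sum_eq_zero fun t ht => hv t ?_
  simp only [mem_filter, mem_univ, true_and] at ht
  omega

lemma downOp_one_upOp {j : ℕ} {v : Finset α → ℂ} (hv : ∀ s, #s ≠ j → v s = 0)
    (hd : downOp 1 v = 0) (m : ℕ) :
    downOp 1 (upOp (m + 1) v) = ((Fintype.card α : ℂ) - 2 * j - m) • upOp m v := by
  have key (m : ℕ) : downOp 1 (upOp 1 (upOp m v)) =
      upOp 1 (downOp 1 (upOp m v)) + ((Fintype.card α : ℂ) - 2 * (j + m)) • upOp m v := by
    ext s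
    rw [downOp_upOp_one, Pi.add_apply, Pi.smul_apply, smul_eq_mul]
    by_cases hs : #s = j + m
    · rw [hs]; push_cast; rfl
    · rw [upOp_eq_zero hv m s hs, mul_zero, mul_zero]
  have hsucc (m : ℕ) : upOp 1 (upOp m v) = ((m : ℂ) + 1) • upOp (m + 1) v := by
    rw [upOp_upOp, add_comm 1 m, Nat.choose_succ_self_right]
    push_cast
    rfl
  induction m with
  | zero =>
    have := key 0
    rw [upOp_zero, hd, map_zero, zero_add] at this
    rw [upOp_zero, this]
    push_cast
    ring_nf
  | succ m ih =>
    have := key (m + 1)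
    rw [ih, map_smul, hsucc, hsucc, map_smul] at this
    have hne : ((m + 1 : ℕ) : ℂ) + 1 ≠ 0 := by exact_mod_cast Nat.succ_ne_zero (m + 1)
    refine smul_right_injective _ hne ?_
    simp only
    rw [this, smul_smul, smul_smul, ← add_smul]
    congr 1
    push_cast
    ring

/-- Iterating `downOp_one_upOp` multiplies the factors card α - 2j - i for m ≤ i < m + r; dividing
by r! leaves a binomial coefficient. The bound `h` makes the natural subtractions exact. -/
lemma downOp_upOp_of_downOp_eq_zero {j : ℕ} {v : Finset α → ℂ}
    (hv : ∀ s, #s ≠ j → v s = 0) (hd : downOp 1 v = 0) (r m : ℕ)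
    (h : 2 * j + (r + m) ≤ Fintype.card α) :
    downOp r (upOp (r + m) v) =
      ((Fintype.card α - 2 * j - (r + m) + r).choose r : ℂ) • upOp m v := by
  induction r generalizing m with
  | zero => simp [downOp_zero]
  | succ r ih =>
    have h1 := downOp_downOp 1 r (upOp (r + 1 + m) v)
    rw [show r + 1 + m = r + (m + 1) by ring, ih (m + 1) (by omega), map_smul,
      downOp_one_upOp hv hd, add_comm 1 r, Nat.choose_one_right, smul_smul] at h1
    have hne : ((r + 1 : ℕ) : ℂ) ≠ 0 := by exact_mod_cast Nat.succ_ne_zero r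
    refine smul_right_injective _ hne ?_
    simp only
    rw [show r + 1 + m = r + (m + 1) by ring, ← h1, smul_smul]
    congr 1
    obtain ⟨c, hc⟩ := Nat.exists_eq_add_of_le h
    have e : (Fintype.card α : ℂ) - 2 * j - m = ((c + r + 1 : ℕ) : ℂ) := by
      rw [hc]; push_cast; ring
    rw [e, hc, show 2 * j + (r + 1 + m) + c - 2 * j - (r + (m + 1)) = c by omega]
    norm_cast
    rw [mul_comm, Nat.add_one_mul_choose_eq, mul_comm, add_assoc]

end BooleanLattice

/-! ### Binomial inversion -/

lemma alternating_sum_choose_mul_choose {l k m : ℕ} (hk : k ≤ l) (hm : m ≤ l) :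
    ∑ r ∈ range (k + 1), (-1 : ℤ) ^ (k - r) * ((l - r).choose (k - r) * m.choose (l - r) : ℕ) =
      if m + k = l then 1 else 0 := by
  -- Trinomial revision pulls out C(m, l-k) and leaves an alternating row sum of Pascal's triangle,
  -- which vanishes unless m = l - k or the prefactor is already zero.
  have h1 : ∀ r ∈ range (k + 1),
      (-1 : ℤ) ^ (k - r) * ((l - r).choose (k - r) * m.choose (l - r) : ℕ) =
        m.choose (l - k) * ((-1) ^ (k - r) * (m - (l - k)).choose (k - r)) := by
    intro r hr
    rw [mem_range] at hr
    have := Nat.choose_mul (n := m) (k := l - r) (s := l - k) (by omega)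
    rw [show l - r - (l - k) = k - r by omega,
      Nat.choose_symm_of_eq_add (show l - r = (l - k) + (k - r) by omega)] at this
    rw [mul_comm ((l - r).choose _), this]
    push_cast
    ring
  rw [sum_congr rfl h1, ← mul_sum,
    ← sum_range_reflect (fun i => (-1 : ℤ) ^ (k - i) * ((m - (l - k)).choose (k - i) : ℤ))]
  have h2 : ∑ i ∈ range (k + 1), (-1 : ℤ) ^ (k - (k + 1 - 1 - i)) *
      ((m - (l - k)).choose (k - (k + 1 - 1 - i)) : ℤ) =
      ∑ i ∈ range (m - (l - k) + 1), (-1 : ℤ) ^ i * ((m - (l - k)).choose i : ℤ) := by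
    symm
    refine sum_subset_zero_on_sdiff (range_mono (by omega)) ?_ ?_
    · intro i hi
      simp only [mem_sdiff, mem_range] at hi
      rw [Nat.choose_eq_zero_of_lt (by omega)]; simp
    · intro i hi
      rw [mem_range] at hi
      rw [show k - (k + 1 - 1 - i) = i by omega]
  rw [h2, Int.alternating_sum_range_choose]
  by_cases h : m + k = l
  · rw [if_pos (by omega), if_pos h, show l - k = m by omega]; simp
  · rw [if_neg h]
    by_cases h' : m < l - k
    · simp [Nat.choose_eq_zero_of_lt h']
    · rw [if_neg (by omega), mul_zero]

/-! ### Hypergeometric form and dual Hahn polynomials -/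

lemma risingFact_succ (a : ℝ) (i : ℕ) : risingFact a (i + 1) = risingFact a i * (a + i) :=
  prod_range_succ _ _

lemma risingFact_one (i : ℕ) : risingFact 1 i = i.factorial := by
  induction i with
  | zero => simp [risingFact]
  | succ i ih => rw [risingFact_succ, ih, Nat.factorial_succ]; push_cast; ring

lemma risingFact_neg_natCast (k i : ℕ) :
    risingFact (-(k : ℝ)) i = (-1) ^ i * (i.factorial * k.choose i : ℕ) := by
  rw [← Nat.descFactorial_eq_factorial_mul_choose]
  induction i with
  | zero => simp [risingFact]
  | succ i ih =>
    rw [risingFact_succ, ih, Nat.descFactorial_succ]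
    rcases le_or_gt i k with h | h
    · push_cast [Nat.cast_sub h]; ring
    · rw [Nat.descFactorial_eq_zero_iff_lt.2 h]; simp

lemma risingFact_natCast_add_one (c i : ℕ) :
    risingFact ((c : ℝ) + 1) i = (i.factorial * (c + i).choose i : ℕ) := by
  rw [← Nat.ascFactorial_eq_factorial_mul_choose]
  induction i with
  | zero => simp [risingFact]
  | succ i ih => rw [risingFact_succ, ih, Nat.ascFactorial_succ]; push_cast; ring

lemma hyp3F2_neg_natCast (k : ℕ) (a₂ a₃ b₁ b₂ : ℝ) :
    hyp3F2 (-(k : ℝ)) a₂ a₃ b₁ b₂ 1 = ∑ i ∈ range (k + 1),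
      risingFact (-(k : ℝ)) i * risingFact a₂ i * risingFact a₃ i /
        (risingFact b₁ i * risingFact b₂ i) / (i.factorial : ℝ) := by
  rw [hyp3F2, tsum_eq_sum (s := range (k + 1))]
  · simp
  · intro i hi
    rw [mem_range, not_lt] at hi
    rw [risingFact_neg_natCast, Nat.choose_eq_zero_of_lt (by omega)]
    simp

theorem alpha_eq_hahnE {n l k j : ℕ} (hl : l ≤ n) (hk : k ≤ l) (hj : j ≤ min l (n - l)) :
    (alpha n l k j : ℝ) = hahnE n l k j := by
  rw [hahnE, hyp3F2_neg_natCast, mul_sum, alpha, Int.cast_sum]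
  refine sum_congr rfl fun i hi => ?_
  rw [mem_range] at hi
  obtain ⟨h1, h2⟩ := le_min_iff.1 hj
  have e1 : -(l : ℝ) + j = -((l - j : ℕ) : ℝ) := by push_cast [Nat.cast_sub h1]; ring
  have e2 : (n : ℝ) - l - j + 1 = ((n - l - j : ℕ) : ℝ) + 1 := by
    push_cast [Nat.cast_sub h2, Nat.cast_sub hl]; ring
  rw [e1, e2, risingFact_one, risingFact_natCast_add_one]
  simp only [risingFact_neg_natCast]
  have hf : (i.factorial : ℝ) ≠ 0 := by exact_mod_cast i.factorial_ne_zero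
  have hc : (l.choose i : ℝ) ≠ 0 := by exact_mod_cast (Nat.choose_pos (by omega)).ne'
  -- This identity absorbs the quotient (-k)_i / (-l)_i into the prefactor C(l, k), so the two sums
  -- agree term by term.
  have hm : (l.choose k : ℝ) * k.choose i = l.choose i * (l - i).choose (k - i) := by
    exact_mod_cast Nat.choose_mul (by omega)
  have hs : (-1 : ℝ) ^ (k - i) * (-1) ^ i = (-1) ^ k := by rw [← pow_add]; congr 1; omega
  have hs2 : (-1 : ℝ) ^ i * (-1) ^ i = 1 := by rw [← mul_pow]; simp
  have hs0 : (-1 : ℝ) ^ i ≠ 0 := by simp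
  push_cast
  rw [← hs]
  field_simp
  rw [show ((-1 : ℝ) ^ i) ^ 2 = 1 by rw [sq, hs2]]
  linear_combination (-(((l - j).choose i : ℝ) * (n - l - j + i).choose i)) * hm

/-- The dual Hahn polynomial with `γ = 0`, as a sum of products of linear factors. -/
noncomputable def dualHahn (δ : ℝ) (N k : ℕ) : Polynomial ℝ :=
  ∑ i ∈ range (k + 1),
    Polynomial.C (risingFact (-(k : ℝ)) i / (risingFact (-(N : ℝ)) i * risingFact 1 i) /
      (i.factorial : ℝ)) *
      ∏ m ∈ range i, (-(Polynomial.X - Polynomial.C ((m : ℝ) * (m + δ + 1))))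

/-- The factors pair up as (-x+m)(x+δ+1+m) = -(λ(x) - λ(m)) with λ(x) = x(x+δ+1), so each term is a
polynomial in λ(x). -/
lemma eval_dualHahn (δ : ℝ) (N k : ℕ) (x : ℝ) :
    (dualHahn δ N k).eval (x * (x + δ + 1)) =
      hyp3F2 (-(k : ℝ)) (-x) (x + δ + 1) (-(N : ℝ)) 1 1 := by
  rw [hyp3F2_neg_natCast, dualHahn, Polynomial.eval_finsetSum]
  refine sum_congr rfl fun i _ => ?_
  have : ∏ m ∈ range i, (-(x * (x + δ + 1) - (m : ℝ) * (m + δ + 1))) =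
      risingFact (-x) i * risingFact (x + δ + 1) i := by
    rw [risingFact, risingFact, ← prod_mul_distrib]
    exact prod_congr rfl fun m _ => by ring
  simp only [Polynomial.eval_mul, Polynomial.eval_C, Polynomial.eval_prod, Polynomial.eval_neg,
    Polynomial.eval_sub, Polynomial.eval_X, this]
  ring

lemma degree_dualHahn (δ : ℝ) {N k : ℕ} (hk : k ≤ N) : (dualHahn δ N k).degree = k := by
  have hp (i : ℕ) : (∏ m ∈ range i,
      (-(Polynomial.X - Polynomial.C ((m : ℝ) * (m + δ + 1))))).degree = (i : WithBot ℕ) := by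
    rw [Polynomial.degree_prod]
    simp only [Polynomial.degree_neg, Polynomial.degree_X_sub_C]
    simp
  -- The leading coefficient survives because k ≤ N keeps (-N)_k nonzero.
  have hc : risingFact (-(k : ℝ)) k / (risingFact (-(N : ℝ)) k * risingFact 1 k) /
      (k.factorial : ℝ) ≠ 0 := by
    have h1 : (k.factorial : ℝ) ≠ 0 := by exact_mod_cast k.factorial_ne_zero
    have h2 : (N.choose k : ℝ) ≠ 0 := by exact_mod_cast (Nat.choose_pos hk).ne'
    simp [risingFact_neg_natCast, risingFact_one, h1, h2]
  have htop : (Polynomial.C (risingFact (-(k : ℝ)) k /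
      (risingFact (-(N : ℝ)) k * risingFact 1 k) / (k.factorial : ℝ)) *
      ∏ m ∈ range k, (-(Polynomial.X - Polynomial.C ((m : ℝ) * (m + δ + 1))))).degree = k := by
    rw [Polynomial.degree_C_mul hc, hp]
  rw [dualHahn, sum_range_succ, Polynomial.degree_add_eq_right_of_degree_lt, htop]
  rw [htop]
  refine (Polynomial.degree_sum_le _ _).trans_lt ?_
  refine (Finset.sup_lt_iff (WithBot.bot_lt_coe k)).2 fun i hi => ?_
  rw [mem_range] at hi
  rw [Polynomial.degree_mul, hp]
  refine (add_le_add_left Polynomial.degree_C_le _).trans_lt ?_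
  rw [zero_add]
  exact WithBot.coe_lt_coe.2 hi

lemma hahnE_eq_eval_dualHahn (n l k : ℕ) (u : ℝ) :
    hahnE n l k u = (-1) ^ k * (l.choose k : ℝ) *
      (dualHahn ((n : ℝ) - 2 * l) l k).eval (((l : ℝ) - u) * ((n : ℝ) - l - u + 1)) := by
  have h := eval_dualHahn ((n : ℝ) - 2 * l) l k ((l : ℝ) - u)
  rw [show (l : ℝ) - u + ((n : ℝ) - 2 * l) + 1 = (n : ℝ) - l - u + 1 by ring,
    show -((l : ℝ) - u) = -(l : ℝ) + u by ring] at h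
  rw [hahnE, h]

lemma isDualHahn_dualHahn (δ : ℝ) {N k : ℕ} (hk : k ≤ N) :
    IsDualHahn 0 δ N k (dualHahn δ N k) :=
  ⟨degree_dualHahn δ hk, fun x => by
    simpa using eval_dualHahn δ N k x⟩

/-! ### The operators A_k through set intersections and U_r D_r -/

section JohnsonScheme

variable {n l : ℕ}

lemma card_ones (x : WeightString n l) : #(onesEquiv n l x).1 = l := (onesEquiv n l x).2

lemma hammingDist_add_two_mul_card_inter (x y : WeightString n l) :
    hammingDist x.1 y.1 + 2 * #((onesEquiv n l x).1 ∩ (onesEquiv n l y).1) = 2 * l := by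
  have hp : ∀ a b : Fin 2, (if a ≠ b then 1 else 0) + 2 * (if a ≠ 0 ∧ b ≠ 0 then 1 else 0) =
      (if a ≠ 0 then 1 else 0) + (if b ≠ 0 then 1 else 0) := by decide
  have hx := x.2
  have hy := y.2
  have hs := sum_congr (rfl : (univ : Finset (Fin n)) = univ) fun i _ => hp (x.1 i) (y.1 i)
  rw [sum_add_distrib, sum_add_distrib, ← mul_sum] at hs
  simp only [← card_filter] at hs
  simp only [hammingNorm] at hx hy
  rw [hx, hy] at hs
  simp only [onesEquiv, Equiv.coe_fn_mk, ← filter_and, hammingDist]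
  omega

lemma hammingDist_eq_two_mul_iff (x y : WeightString n l) (k : ℕ) :
    hammingDist x.1 y.1 = 2 * k ↔
      #((onesEquiv n l x).1 ∩ (onesEquiv n l y).1) + k = l := by
  have := hammingDist_add_two_mul_card_inter x y
  omega

lemma opA_apply (k : ℕ) (v : WeightSpace n l) (x : WeightString n l) :
    opA n l k v x = ∑ y, if hammingDist x.1 y.1 = 2 * k then v y else 0 := by
  have h : opA n l k v x = ∑ p : WeightString n l × WeightString n l,
      if hammingDist p.1.1 p.2.1 = 2 * k then v p.2 * (if x = p.1 then 1 else 0) else 0 := by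
    rw [← sum_filter]
    simp [opA, LinearMap.sum_apply, ket, EuclideanSpace.inner_single_left,
      InnerProductSpace.rankOne_apply, Pi.single_apply]
  rw [h, Fintype.sum_prod_type, sum_comm]
  refine sum_congr rfl fun y _ => ?_
  rw [sum_eq_single x]
  · simp
  · intro z _ hz
    simp [hz.symm]
  · simp

lemma opA_isSymmetric (n l k : ℕ) : (opA n l k).IsSymmetric := by
  intro v w
  simp only [PiLp.inner_apply, opA_apply, RCLike.inner_apply, map_sum, sum_mul, mul_sum]
  rw [sum_comm]
  refine sum_congr rfl fun x _ => sum_congr rfl fun y _ => ?_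
  rw [hammingDist_comm]
  split_ifs <;> simp

theorem toMatrix_opA (n l k : ℕ) :
    LinearMap.toMatrix (EuclideanSpace.basisFun (WeightString n l) ℂ).toBasis
        (EuclideanSpace.basisFun (WeightString n l) ℂ).toBasis (opA n l k) =
      (johnsonAdj n l k).submatrix (onesEquiv n l) (onesEquiv n l) := by
  ext x y
  rw [LinearMap.toMatrix_apply]
  simp only [OrthonormalBasis.coe_toBasis, EuclideanSpace.basisFun_apply,
    OrthonormalBasis.coe_toBasis_repr_apply, EuclideanSpace.basisFun_repr, opA_apply,
    johnsonAdj, Matrix.submatrix_apply, Matrix.of_apply, ← hammingDist_eq_two_mul_iff]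
  rw [sum_eq_single y]
  · simp
  · intro z _ hz
    simp [hz]
  · simp

/-- The restriction of a function on all sets of positions to those of size `l`. -/
noncomputable def restrictWeight (n l : ℕ) : (Finset (Fin n) → ℂ) →ₗ[ℂ] WeightSpace n l :=
  (WithLp.linearEquiv 2 ℂ (WeightString n l → ℂ)).symm.toLinearMap ∘ₗ
    LinearMap.funLeft ℂ ℂ fun x => (onesEquiv n l x).1

lemma restrictWeight_apply (f : Finset (Fin n) → ℂ) (x : WeightString n l) :
    restrictWeight n l f x = f (onesEquiv n l x).1 := rfl

lemma opA_restrictWeight {k : ℕ} (hk : k ≤ l) (f : Finset (Fin n) → ℂ) :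
    opA n l k (restrictWeight n l f) = ∑ r ∈ range (k + 1),
      ((-1) ^ (k - r) * (l - r).choose (k - r) : ℂ) •
        restrictWeight n l (upOp r (downOp r f)) := by
  ext x
  have h1 (r : ℕ) (hr : r ≤ l) : upOp r (downOp r f) (onesEquiv n l x).1 =
      ∑ y : WeightString n l,
        ((#((onesEquiv n l x).1 ∩ (onesEquiv n l y).1)).choose (l - r) : ℂ) *
          f (onesEquiv n l y).1 := by
    rw [upOp_downOp_apply _ _ _ (by rwa [card_ones]), card_ones]
    rw [sum_subtype (p := fun u => #u = l) _ (by simp), ← (onesEquiv n l).sum_comp]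
  rw [opA_apply, WithLp.ofLp_sum, Finset.sum_apply]
  simp only [PiLp.smul_apply, smul_eq_mul, restrictWeight_apply]
  have h3 : ∀ r ∈ range (k + 1), ((-1) ^ (k - r) * (l - r).choose (k - r) : ℂ) *
      upOp r (downOp r f) (onesEquiv n l x).1 = ∑ y : WeightString n l,
        ((-1) ^ (k - r) * (l - r).choose (k - r) : ℂ) *
          (((#((onesEquiv n l x).1 ∩ (onesEquiv n l y).1)).choose (l - r) : ℂ) *
            f (onesEquiv n l y).1) := fun r hr => by
    rw [h1 r (by rw [mem_range] at hr; omega), mul_sum]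
  rw [sum_congr rfl h3, sum_comm]
  refine sum_congr rfl fun y _ => ?_
  have h2 := congrArg (Int.cast (R := ℂ)) (alternating_sum_choose_mul_choose hk
    (show #((onesEquiv n l x).1 ∩ (onesEquiv n l y).1) ≤ l from
      (card_le_card inter_subset_left).trans (card_ones x).le))
  push_cast at h2
  simp only [← mul_assoc] at h2 ⊢
  rw [← sum_mul, h2]
  simp only [hammingDist_eq_two_mul_iff]
  split_ifs <;> simp

lemma opA_restrictWeight_upOp {j k : ℕ} (hj : j ≤ min l (n - l)) (hl : l ≤ n) (hk : k ≤ l)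
    {v : Finset (Fin n) → ℂ} (hv : ∀ s, #s ≠ j → v s = 0) (hd : downOp 1 v = 0) :
    opA n l k (restrictWeight n l (upOp (l - j) v)) =
      (alpha n l k j : ℂ) • restrictWeight n l (upOp (l - j) v) := by
  obtain ⟨h1, h2⟩ := le_min_iff.1 hj
  rw [opA_restrictWeight hk, alpha, Int.cast_sum, sum_smul]
  refine sum_congr rfl fun r hr => ?_
  rw [mem_range] at hr
  rcases le_or_gt r (l - j) with h | h
  · obtain ⟨m, hm⟩ := Nat.exists_eq_add_of_le h
    rw [hm, downOp_upOp_of_downOp_eq_zero hv hd r m (by rw [Fintype.card_fin]; omega),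
      map_smul, upOp_upOp, smul_smul, map_smul, smul_smul, Fintype.card_fin,
      show n - 2 * j - (r + m) + r = n - l - j + r by omega, Nat.choose_symm_add]
    congr 1
    push_cast
    ring
  · rw [Nat.choose_eq_zero_of_lt h]
    -- Here r > l - j, so D_r is proportional to D_{q+1} D_{l-j}: the second factor returns a
    -- multiple of v, which the first kills.
    have : restrictWeight n l (upOp r (downOp r (upOp (l - j) v))) = 0 := by
      obtain ⟨q, hq⟩ := Nat.exists_eq_add_of_lt h
      have e := downOp_downOp (q + 1) (l - j) (upOp (l - j) v)
      have e0 := downOp_upOp_of_downOp_eq_zero hv hd (l - j) 0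
        (by rw [Fintype.card_fin]; omega)
      have e1 := downOp_downOp q 1 v
      rw [hd, map_zero] at e1
      rw [add_zero, upOp_zero] at e0
      have hc : ((q + 1).choose q : ℂ) ≠ 0 := by
        exact_mod_cast (Nat.choose_pos (by omega)).ne'
      have hc' : ((q + 1 + (l - j)).choose (q + 1) : ℂ) ≠ 0 := by
        exact_mod_cast (Nat.choose_pos (by omega)).ne'
      have e2 : downOp (q + 1) v = 0 := (smul_eq_zero.1 e1.symm).resolve_left hc
      rw [e0, map_smul, e2, smul_zero] at e
      have e3 := (smul_eq_zero.1 e.symm).resolve_left hc'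
      rw [show r = q + 1 + (l - j) by omega, e3, map_zero, map_zero]
    rw [this]
    simp

/-! ### Lower bounds for the common eigenspaces -/

/-- Extension by zero of a function on the sets of size `j`. -/
noncomputable def extendLevel (n j : ℕ) :
    ({s : Finset (Fin n) // #s = j} → ℂ) →ₗ[ℂ] (Finset (Fin n) → ℂ) :=
  Function.ExtendByZero.linearMap ℂ Subtype.val

lemma extendLevel_coe {j : ℕ} (v : {s : Finset (Fin n) // #s = j} → ℂ)
    (s : {s : Finset (Fin n) // #s = j}) : extendLevel n j v s.1 = v s :=
  Subtype.val_injective.extend_apply v 0 s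

lemma extendLevel_eq_zero {j : ℕ} (v : {s : Finset (Fin n) // #s = j} → ℂ)
    (s : Finset (Fin n)) (hs : #s ≠ j) : extendLevel n j v s = 0 :=
  Function.extend_apply' _ _ _ (by rintro ⟨a, rfl⟩; exact hs a.2)

/-- The lowering operator from the sets of size `j` to those of size `j - 1` (none if `j = 0`). -/
noncomputable def lowerLevel (n j : ℕ) :
    ({s : Finset (Fin n) // #s = j} → ℂ) →ₗ[ℂ] ({s : Finset (Fin n) // #s + 1 = j} → ℂ) :=
  LinearMap.funLeft ℂ ℂ Subtype.val ∘ₗ downOp 1 ∘ₗ extendLevel n j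

lemma downOp_extendLevel {j : ℕ} {v : {s : Finset (Fin n) // #s = j} → ℂ}
    (hv : v ∈ LinearMap.ker (lowerLevel n j)) : downOp 1 (extendLevel n j v) = 0 := by
  ext s
  by_cases hs : #s + 1 = j
  · exact congrFun (LinearMap.mem_ker.1 hv) ⟨s, hs⟩
  · rw [downOp_apply]
    refine sum_eq_zero fun t ht => extendLevel_eq_zero v t ?_
    simp only [mem_filter, mem_univ, true_and] at ht
    omega

lemma card_succ_eq_zero (n : ℕ) : Fintype.card {s : Finset (Fin n) // #s + 1 = 0} = 0 := by
  simp

lemma card_succ_eq (n j : ℕ) :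
    Fintype.card {s : Finset (Fin n) // #s + 1 = j + 1} = n.choose j := by
  simp only [Nat.add_right_cancel_iff]
  rw [Fintype.card_finset_len, Fintype.card_fin]

/-- Rank-nullity for `lowerLevel`, in additive form so that j = 0 needs no truncated subtraction or
separate case. -/
lemma choose_le_finrank_commonEigenspace {j : ℕ} (hl : l ≤ n) (hj : j ≤ min l (n - l)) :
    n.choose j ≤ Module.finrank ℂ (commonEigenspace n l j) +
      Fintype.card {s : Finset (Fin n) // #s + 1 = j} := by
  obtain ⟨h1, h2⟩ := le_min_iff.1 hj
  let T := restrictWeight n l ∘ₗ upOp (l - j) ∘ₗ extendLevel n j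
  have hle : (LinearMap.ker (lowerLevel n j)).map T ≤ commonEigenspace n l j := by
    rintro _ ⟨v, hv, rfl⟩
    simp only [commonEigenspace, Submodule.mem_iInf, Module.End.mem_eigenspace_iff, mem_range]
    exact fun k hk => opA_restrictWeight_upOp hj hl (by omega) (extendLevel_eq_zero v)
      (downOp_extendLevel hv)
  -- Up to a nonzero scalar, `downOp (l - j)` is a left inverse of the raising map on the kernel.
  have hinj : Function.Injective (T.domRestrict (LinearMap.ker (lowerLevel n j))) := by
    rw [← LinearMap.ker_eq_bot, LinearMap.ker_eq_bot']
    rintro ⟨v, hv⟩ h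
    have h0 : upOp (l - j) (extendLevel n j v) = 0 := by
      ext s
      by_cases hs : #s = l
      · have := congrArg (fun w : WeightSpace n l => w ((onesEquiv n l).symm ⟨s, hs⟩)) h
        simpa [T, restrictWeight_apply] using this
      · exact upOp_eq_zero (extendLevel_eq_zero v) _ _ (by omega)
    have e := downOp_upOp_of_downOp_eq_zero (extendLevel_eq_zero v) (downOp_extendLevel hv)
      (l - j) 0 (by rw [Fintype.card_fin]; omega)
    rw [add_zero, h0, map_zero, upOp_zero] at e
    have hc : ((Fintype.card (Fin n) - 2 * j - (l - j) + (l - j)).choose (l - j) : ℂ) ≠ 0 := by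
      exact_mod_cast (Nat.choose_pos (by omega)).ne'
    have e' := (smul_eq_zero.1 e.symm).resolve_left hc
    ext s
    exact (extendLevel_coe v s).symm.trans (congrFun e' s)
  have hr : Module.finrank ℂ (LinearMap.ker (lowerLevel n j)) ≤
      Module.finrank ℂ (commonEigenspace n l j) := by
    refine le_trans ?_ (Submodule.finrank_mono hle)
    rw [← LinearMap.range_domRestrict, LinearMap.finrank_range_of_inj hinj]
  have hn := LinearMap.finrank_range_add_finrank_ker (lowerLevel n j)
  have hR := Submodule.finrank_le (LinearMap.range (lowerLevel n j))
  rw [Module.finrank_fintype_fun_eq_card] at hn hR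
  rw [Fintype.card_finset_len, Fintype.card_fin] at hn
  omega

/-! ### Orthogonality, dimension count and spectrum -/

lemma alpha_one (n l j : ℕ) :
    alpha n l 1 j = -(l : ℤ) + ((l - j : ℕ) : ℤ) * ((n - l - j : ℕ) + 1) := by
  simp [alpha, sum_range_succ]

/-- Up to a constant, α_1(j) is (l-j)(n-l-j+1), whose factors both decrease in j. -/
lemma alpha_one_injOn (n l : ℕ) : Set.InjOn (alpha n l 1) (Set.Iic (min l (n - l))) := by
  have key : ∀ i j, i < j → j ≤ min l (n - l) → alpha n l 1 j < alpha n l 1 i := by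
    intro i j hij hj
    obtain ⟨h1, h2⟩ := le_min_iff.1 hj
    rw [alpha_one, alpha_one]
    have : (l - j) * (n - l - j + 1) < (l - i) * (n - l - i + 1) :=
      Nat.mul_lt_mul_of_le_of_lt (by omega) (by omega) (by omega)
    zify at this
    linarith
  intro i hi j hj h
  rcases lt_trichotomy i j with hij | hij | hij
  · exact absurd h (key i j hij hj).ne'
  · exact hij
  · exact absurd h (key j i hij hi).ne

lemma commonEigenspace_le {k : ℕ} (hk : k ≤ l) (j : ℕ) :
    commonEigenspace n l j ≤ (opA n l k).eigenspace (alpha n l k j : ℂ) :=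
  iInf₂_le k (mem_range.2 (by omega))

theorem orthogonalFamily_commonEigenspace (n l : ℕ) :
    OrthogonalFamily ℂ (fun j : Fin (min l (n - l) + 1) => commonEigenspace n l j)
      (fun j => (commonEigenspace n l j).subtypeₗᵢ) := by
  intro i j hij v w
  have hne : i.1 ≠ j.1 := fun h => hij (Fin.ext h)
  have hi := i.2
  have hj := j.2
  -- Two distinct indices force min(l, n-l) ≥ 1, so A_1 is among the operators defining the B_j.
  have h1 : 1 ≤ l := by omega
  have ha : (alpha n l 1 i : ℂ) ≠ alpha n l 1 j := fun h => hne <|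
    alpha_one_injOn n l (Set.mem_Iic.2 (by omega)) (Set.mem_Iic.2 (by omega))
      (by exact_mod_cast h)
  exact (opA_isSymmetric n l 1).orthogonalFamily_eigenspaces ha
    ⟨v, commonEigenspace_le h1 _ v.2⟩ ⟨w, commonEigenspace_le h1 _ w.2⟩

lemma finrank_weightSpace (n l : ℕ) : Module.finrank ℂ (WeightSpace n l) = n.choose l := by
  rw [finrank_euclideanSpace, Fintype.card_congr (onesEquiv n l), Fintype.card_finset_len,
    Fintype.card_fin]

lemma injective_coeLinearMap_commonEigenspace (n l : ℕ) : Function.Injective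
    (DirectSum.coeLinearMap fun j : Fin (min l (n - l) + 1) => commonEigenspace n l j) :=
  (orthogonalFamily_commonEigenspace n l).independent.dfinsupp_lsum_injective

lemma sum_finrank_commonEigenspace_le (n l : ℕ) :
    ∑ j ∈ range (min l (n - l) + 1), Module.finrank ℂ (commonEigenspace n l j) ≤
      n.choose l := by
  have := LinearMap.finrank_le_finrank_of_injective
    (injective_coeLinearMap_commonEigenspace n l)
  rwa [Module.finrank_directSum, finrank_weightSpace,
    Fin.sum_univ_eq_sum_range (fun j => Module.finrank ℂ (commonEigenspace n l j))] at this

lemma choose_min_eq (hl : l ≤ n) : n.choose (min l (n - l)) = n.choose l := by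
  rcases min_choice l (n - l) with h | h
  · rw [h]
  · rw [h, Nat.choose_symm hl]

lemma sum_card_add_choose (n p : ℕ) :
    ∑ j ∈ range (p + 1), n.choose j =
      n.choose p + ∑ j ∈ range (p + 1), Fintype.card {s : Finset (Fin n) // #s + 1 = j} := by
  rw [sum_range_succ, sum_range_succ', card_succ_eq_zero]
  simp only [card_succ_eq]
  ring

/-- The termwise lower bounds and the upper bound on the total have the same sum, so each is
attained. -/
lemma choose_eq_finrank_commonEigenspace_add {j : ℕ} (hl : l ≤ n) (hj : j ≤ min l (n - l)) :
    n.choose j = Module.finrank ℂ (commonEigenspace n l j) +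
      Fintype.card {s : Finset (Fin n) // #s + 1 = j} := by
  have hle : ∀ i ∈ range (min l (n - l) + 1), n.choose i ≤
      Module.finrank ℂ (commonEigenspace n l i) +
        Fintype.card {s : Finset (Fin n) // #s + 1 = i} := fun i hi =>
    choose_le_finrank_commonEigenspace hl (by rw [mem_range] at hi; omega)
  refine (sum_eq_sum_iff_of_le hle).1 (le_antisymm (sum_le_sum hle) ?_) j
    (mem_range.2 (by omega))
  rw [sum_add_distrib, sum_card_add_choose, choose_min_eq hl]
  exact Nat.add_le_add_right (sum_finrank_commonEigenspace_le n l) _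

theorem isInternal_commonEigenspace (hl : l ≤ n) : DirectSum.IsInternal
    (fun j : Fin (min l (n - l) + 1) => commonEigenspace n l j) := by
  have hinj := injective_coeLinearMap_commonEigenspace n l
  refine ⟨hinj, ?_⟩
  refine (LinearMap.injective_iff_surjective_of_finrank_eq_finrank ?_).1 hinj
  rw [Module.finrank_directSum, finrank_weightSpace,
    Fin.sum_univ_eq_sum_range (fun j => Module.finrank ℂ (commonEigenspace n l j))]
  have h := sum_congr rfl fun i (hi : i ∈ range (min l (n - l) + 1)) =>
    choose_eq_finrank_commonEigenspace_add hl (j := i) (by rw [mem_range] at hi; omega)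
  rw [sum_add_distrib, sum_card_add_choose, choose_min_eq hl] at h
  omega

theorem finrank_commonEigenspace {j : ℕ} (hl : l ≤ n) (hj : j ≤ min l (n - l)) :
    (Module.finrank ℂ (commonEigenspace n l j) : ℝ) =
      (n.choose j : ℝ) * (((n : ℝ) - 2 * j + 1) / ((n : ℝ) - j + 1)) := by
  have h := choose_eq_finrank_commonEigenspace_add hl hj
  have hjn : j ≤ n := by omega
  have hpos : (n : ℝ) - j + 1 ≠ 0 := by
    have : (j : ℝ) ≤ n := by exact_mod_cast hjn
    linarith
  rw [mul_div_assoc', eq_div_iff hpos]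
  cases j with
  | zero =>
    rw [card_succ_eq_zero] at h
    rw [add_zero] at h
    simp [← h]
  | succ j =>
    rw [card_succ_eq] at h
    have h1 := Nat.choose_succ_right_eq n j
    have h' : (n.choose (j + 1) : ℝ) =
      Module.finrank ℂ (commonEigenspace n l (j + 1)) + n.choose j := by exact_mod_cast h
    have h1' : (n.choose (j + 1) : ℝ) * (j + 1) = n.choose j * (n - j) := by
      rw [← Nat.cast_sub (by omega)]; exact_mod_cast h1
    push_cast
    linear_combination (-(n : ℝ) + j) * h' + h1'

lemma commonEigenspace_ne_bot {j : ℕ} (hl : l ≤ n) (hj : j ≤ min l (n - l)) :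
    commonEigenspace n l j ≠ ⊥ := by
  intro h
  have hf := finrank_commonEigenspace hl hj
  rw [h, finrank_bot] at hf
  have h1 : (2 * j : ℝ) ≤ n := by exact_mod_cast (by omega : 2 * j ≤ n)
  have h2 : (0 : ℝ) < n.choose j := by exact_mod_cast Nat.choose_pos (by omega)
  have h3 : (0 : ℝ) ≤ j := by positivity
  have : (0 : ℝ) < (n.choose j : ℝ) * (((n : ℝ) - 2 * j + 1) / ((n : ℝ) - j + 1)) :=
    mul_pos h2 (div_pos (by linarith) (by linarith))
  simp only [Nat.cast_zero] at hf
  linarith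

theorem hasEigenvalue_opA_iff {k : ℕ} (hl : l ≤ n) (hk : k ≤ l) (μ : ℂ) :
    (opA n l k).HasEigenvalue μ ↔ ∃ j ≤ min l (n - l), μ = (alpha n l k j : ℂ) := by
  constructor
  · intro h
    by_contra! hne
    have htop := (isInternal_commonEigenspace hl).submodule_iSup_eq_top
    -- Any other eigenvalue would have its eigenspace orthogonal to every B_j, hence to the whole
    -- space.
    have hle : (⊤ : Submodule ℂ (WeightSpace n l)) ≤ ((opA n l k).eigenspace μ)ᗮ := by
      rw [← htop]
      refine iSup_le fun j v hv => ?_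
      rw [Submodule.mem_orthogonal]
      intro w hw
      exact (opA_isSymmetric n l k).orthogonalFamily_eigenspaces
        (hne j (by have := j.2; omega)) ⟨w, hw⟩ ⟨v, commonEigenspace_le hk _ hv⟩
    exact h ((Submodule.orthogonal_eq_top_iff _).1 (top_le_iff.1 hle))
  · rintro ⟨j, hj, rfl⟩
    exact fun h => commonEigenspace_ne_bot hl hj
      (le_bot_iff.1 (h ▸ commonEigenspace_le hk j))

end JohnsonScheme

theorem mainTheorem2 (n l : ℕ) (hl : l ≤ n) :
    -- the eigenvalues of `A_k^{(l)}` are exactly the numbers `α_k(j)`, `0 ≤ j ≤ min l (n - l)`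
    (∀ k ≤ l, ∀ μ : ℂ, (opA n l k).HasEigenvalue μ ↔
      ∃ j ≤ min l (n - l), μ = (alpha n l k j : ℂ)) ∧
    -- `j` labels the common eigenspaces, whose dimensions are the multiplicities `f_j`
    DirectSum.IsInternal
      (fun j : Fin (min l (n - l) + 1) => commonEigenspace n l j) ∧
    OrthogonalFamily ℂ (fun j : Fin (min l (n - l) + 1) => commonEigenspace n l j)
      (fun j => (commonEigenspace n l j).subtypeₗᵢ) ∧
    (∀ j ≤ min l (n - l), (Module.finrank ℂ (commonEigenspace n l j) : ℝ) =
      (n.choose j : ℝ) * (((n : ℝ) - 2 * j + 1) / ((n : ℝ) - j + 1))) ∧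
    -- hypergeometric form
    (∀ k ≤ l, ∀ j ≤ min l (n - l), (alpha n l k j : ℝ) = hahnE n l k j) ∧
    -- `E_k` is, up to normalization, a dual Hahn polynomial
    (∀ k ≤ l, ∃ R : Polynomial ℝ, IsDualHahn 0 ((n : ℝ) - 2 * l) l k R ∧
      ∀ u : ℝ, hahnE n l k u =
        (-1) ^ k * (l.choose k : ℝ) * R.eval (((l : ℝ) - u) * ((n : ℝ) - l - u + 1))) ∧
    -- in the standard basis, `A_k^{(l)}` is the `k`-th adjacency matrix of the Johnson scheme
    (∀ k ≤ l, LinearMap.toMatrix (EuclideanSpace.basisFun (WeightString n l) ℂ).toBasis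
        (EuclideanSpace.basisFun (WeightString n l) ℂ).toBasis (opA n l k) =
      (johnsonAdj n l k).submatrix (onesEquiv n l) (onesEquiv n l)) := by
  exact ⟨fun k hk μ => hasEigenvalue_opA_iff hl hk μ,
    isInternal_commonEigenspace hl,
    orthogonalFamily_commonEigenspace n l,
    fun j hj => finrank_commonEigenspace hl hj,
    fun k hk j hj => alpha_eq_hahnE hl hk hj,
    fun k hk => ⟨_, isDualHahn_dualHahn _ hk, hahnE_eq_eval_dualHahn n l k⟩,
    fun k _ => toMatrix_opA n l k⟩
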